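/- Let $X$ be a finite alphabet, $X^*$ the set of finite words over $X$ with the prefix order $\sqsubseteq$, $X^n$ the set of words of length $n$, and $\mathrm{Aut}(X^*)$ the group of bijections of $X^*$ that preserve and reflect $\sqsubseteq$. For $g\in\mathrm{Aut}(X^*)$ and $u\in X^*$ let $\psi_u(g)=g_u\in\mathrm{Aut}(X^*)$ be the section determined by $g(uw)=g(u)\,g_u(w)$ for all $w\in X^*$, and write $\psi_u(S)=\{\psi_u(g): g\in S\}$. For $H\le\mathrm{Aut}(X^*)$ and $Y\subseteq X^*$ let $\mathrm{st}_H(Y)$ be the pointwise stabilizer of $Y$ in $H$ and $\mathrm{st}_H(n)=\mathrm{st}_H(X^n)$. Let $H^Y$ be the group of all $g\in \mathrm{Aut}(X^*)$ that fix each $y\in Y$ with $\psi_y(g)\in H$ and fix every word having no prefix in $Y$. A finite set $Y\subseteq X^*$ is a spanning leaf set if no element of $Y$ is a prefix of another one and every sufficiently long word has a prefix in $Y$. Let $G\le \mathrm{Aut}(X^*)$ be a subgroup such that: * $G$ is finitely generated; * $G$ is a regular branch group: $\psi_u(g)\in G$ for all $g\in G$, $u\in X^*$; $G$ acts transitively on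 every $X^n$; and there is a normal subgroup $K$ of finite index in $G$ such that $K^{\{x\}}\le K$ for all $x\in X^*$ and $K^{X^n}$ is a subgroup of finite index in $G$ for all $n\geq 0$; * $G$ is just infinite: $G$ is infinite and $G/N$ is finite for every non-trivial normal subgroup $N$ of $G$; * $G$ is strongly self-replicating: $\psi_x(\mathrm{st}_G(n))=G$ for all $n\ge 1$ and $x\in X^n$; * $G$ has well-approximated subgroups: $\bigcap_{n\ge 0}H\,\mathrm{st}_G(n)=H$ for every finitely generated $H\le G$; * $G$ obeys the Grigorchuk--Nagnibeda alternative: for every finitely generated $H\le G$, either $\psi_y(H)$ is finite for some $y\in X^*$, or there is a spanning leaf set $Y\subseteq X^*$ such that $\mathrm{st}_H(Y)$ is an infra-direct product of $G^Y$, i.e. $\mathrm{st}_H(Y)\le G^Y$ and $\psi_y(\mathrm{st}_H(Y))$ has finite index in $G$ for all $y\in Y$. Let $\mathrm{Sub}(G)$ be the Chabauty space of all subgroups of $G$, with the topology induced from the product topology on $\{0,1\}^G$ through indicator functions. Its perfect kernel is the intersection of all its transfinite Cantor--Bendixson derivatives (equivalently, the derivative at which the sequence stabilizes). Then for every subgroup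 $H\le G$, $H$ lies in the perfect kernel of $\mathrm{Sub}(G)$ if and only if 1. $\psi_y(H)$ is finite for some $y\in X^*$, or 2. $H$ is not finitely generated. -/

import Mathlib

/-- `Aut(X^*)`: the bijections of the set of finite words over `X` that preserve and reflect the
prefix relation; multiplication is composition, `(g * h) u = g (h u)`. -/
abbrev TreeAut (X : Type*) : Type _ :=
  (fun u v : List X => u <+: v) ≃r (fun u v : List X => u <+: v)

namespace TreeAut

variable {X : Type*}

theorem map_prefix (g : TreeAut X) {u v : List X} (h : u <+: v) : g u <+: g v :=
  g.map_rel_iff.2 h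

theorem apply_append_eq (g : TreeAut X) (u w : List X) :
    g u ++ (g (u ++ w)).drop (g u).length = g (u ++ w) := by
  obtain ⟨t, ht⟩ := g.map_prefix (List.prefix_append u w)
  rw [← ht, List.drop_left]

theorem symm_append_eq (g : TreeAut X) (u w : List X) :
    u ++ (g.symm (g u ++ w)).drop u.length = g.symm (g u ++ w) := by
  have h := apply_append_eq g.symm (g u) w
  rwa [g.symm_apply_apply] at h

/-- The section map `ψ_u : g ↦ g_u`, where `g_u` is the automorphism with
`g (u ++ w) = g u ++ g_u w` for all words `w`. -/
def psi (u : List X) (g : TreeAut X) : TreeAut X where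
  toFun w := (g (u ++ w)).drop (g u).length
  invFun w := (g.symm (g u ++ w)).drop u.length
  left_inv w := by
    simp only
    rw [apply_append_eq, g.symm_apply_apply, List.drop_left]
  right_inv w := by
    simp only
    rw [symm_append_eq, g.apply_symm_apply, List.drop_left]
  map_rel_iff' := by
    intro v w
    simp only [Equiv.coe_fn_mk]
    rw [← List.prefix_append_right_inj (g u), apply_append_eq, apply_append_eq,
      g.map_rel_iff, List.prefix_append_right_inj]

/-- The defining property of sections. -/
theorem apply_append (g : TreeAut X) (u w : List X) : g (u ++ w) = g u ++ psi u g w :=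
  (apply_append_eq g u w).symm

theorem psi_one (u : List X) : psi u (1 : TreeAut X) = 1 := by
  ext1 w
  apply List.append_cancel_left (as := u)
  have h := apply_append (1 : TreeAut X) u w
  simpa using h.symm

theorem psi_mul (u : List X) (g h : TreeAut X) : psi u (g * h) = psi (h u) g * psi u h := by
  ext1 w
  apply List.append_cancel_left (as := g (h u))
  have e := apply_append (g * h) u w
  rw [RelIso.mul_apply, RelIso.mul_apply, apply_append h, apply_append g] at e
  exact e.symm

/-- The section map at `u`, a homomorphism on the stabilizer of `u` in `Aut(X^*)`. -/
def psiHom (u : List X) : MulAction.stabilizer (TreeAut X) u →* TreeAut X where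
  toFun g := psi u g.1
  map_one' := psi_one u
  map_mul' g h := by
    have hh : h.1 u = u := h.2
    rw [Subgroup.coe_mul, psi_mul, hh]

/-- The set `X^n` of words of length `n`. -/
def level (X : Type*) (n : ℕ) : Set (List X) := {u | u.length = n}

/-- `st_G(Y)`: the pointwise stabilizer of `Y` in `G`. -/
def st (G : Subgroup (TreeAut X)) (Y : Set (List X)) : Subgroup (TreeAut X) :=
  G ⊓ ⨅ y ∈ Y, MulAction.stabilizer (TreeAut X) y

/-- `Y` is a leaf set: a finite set of words, none of which is a prefix of another. -/
def IsLeafSet (Y : Set (List X)) : Prop :=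
  Y.Finite ∧ ∀ x ∈ Y, ∀ y ∈ Y, x ≠ y → ¬ x <+: y

/-- A spanning leaf set: every sufficiently long word has a prefix in `Y`. -/
def IsSpanningLeafSet (Y : Set (List X)) : Prop :=
  IsLeafSet Y ∧ ∃ N : ℕ, ∀ x : List X, N ≤ x.length → ∃ y ∈ Y, y <+: x

/-- `G^Y`: the group acting as a copy of `G` on the subtree rooted at each `y ∈ Y`. It consists
of the automorphisms that fix every `y ∈ Y`, have their section at `y` in `G` for every `y ∈ Y`,
and fix every word that does not lie below an element of `Y`. -/
def copies (G : Subgroup (TreeAut X)) (Y : Set (List X)) : Subgroup (TreeAut X) where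
  carrier := {g | (∀ y ∈ Y, g y = y ∧ psi y g ∈ G) ∧
    ∀ v : List X, (∀ y ∈ Y, ¬ y <+: v) → g v = v}
  one_mem' := ⟨fun y _ => ⟨rfl, by rw [psi_one]; exact G.one_mem⟩, fun _ _ => rfl⟩
  mul_mem' := by
    rintro g h ⟨hg, hg'⟩ ⟨hh, hh'⟩
    refine ⟨fun y hy => ⟨?_, ?_⟩, fun v hv => ?_⟩
    · rw [RelIso.mul_apply, (hh y hy).1, (hg y hy).1]
    · rw [psi_mul, (hh y hy).1]
      exact G.mul_mem (hg y hy).2 (hh y hy).2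
    · rw [RelIso.mul_apply, hh' v hv, hg' v hv]
  inv_mem' := by
    rintro g ⟨hg, hg'⟩
    have key : ∀ v, g v = v → g⁻¹ v = v := fun v hv => by
      conv_lhs => rw [← hv]
      exact RelIso.inv_apply_self g v
    refine ⟨fun y hy => ⟨key y (hg y hy).1, ?_⟩, fun v hv => key v (hg' v hv)⟩
    have e := psi_mul y g⁻¹ g
    rw [inv_mul_cancel, psi_one, (hg y hy).1] at e
    rw [eq_inv_of_mul_eq_one_left e.symm]
    exact G.inv_mem (hg y hy).2

/-- `A` is a finite index subgroup of `B`. -/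
def IsFiniteIndexSubgroup {Γ : Type*} [Group Γ] (A B : Subgroup Γ) : Prop :=
  A ≤ B ∧ A.IsFiniteRelIndex B

/-- `H` is an infra-direct product of `G^Y`: `H ≤ G^Y`, and for every `y ∈ Y` the projection
`ψ_y(H)` to the coordinate `y` has finite index in `G`. -/
def IsInfraDirectProduct (G : Subgroup (TreeAut X)) (Y : Set (List X))
    (H : Subgroup (TreeAut X)) : Prop :=
  H ≤ copies G Y ∧ ∀ y ∈ Y, IsFiniteIndexSubgroup
    ((H.subgroupOf (MulAction.stabilizer (TreeAut X) y)).map (psiHom y)) G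

/-- `G` is self-similar. -/
def IsSelfSimilar (G : Subgroup (TreeAut X)) : Prop :=
  ∀ g ∈ G, ∀ u : List X, psi u g ∈ G

/-- `G` is strongly self-replicating: `ψ_x(st_G(n)) = G` for all `n ≥ 1` and `x ∈ X^n`. -/
def IsStronglySelfReplicating (G : Subgroup (TreeAut X)) : Prop :=
  ∀ n : ℕ, 1 ≤ n → ∀ x ∈ level X n,
    psi x '' (st G (level X n) : Set (TreeAut X)) = (G : Set (TreeAut X))

/-- `G` acts transitively on every level. -/
def IsLevelTransitive (G : Subgroup (TreeAut X)) : Prop :=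
  ∀ n : ℕ, ∀ u ∈ level X n, ∀ v ∈ level X n, ∃ g ∈ G, g u = v

/-- `G` is a regular branch group. -/
def IsRegularBranch (G : Subgroup (TreeAut X)) : Prop :=
  IsSelfSimilar G ∧ IsLevelTransitive G ∧
    ∃ K : Subgroup (TreeAut X),
      IsFiniteIndexSubgroup K G ∧ (K.subgroupOf G).Normal ∧
      (∀ x : List X, copies K {x} ≤ K) ∧
      ∀ n : ℕ, IsFiniteIndexSubgroup (copies K (level X n)) G

open scoped Pointwise in
/-- `G` has well-approximated subgroups: `⋂ n, H st_G(n) = H` for every finitely generated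
subgroup `H` of `G`. -/
def HasWellApproximatedSubgroups (G : Subgroup (TreeAut X)) : Prop :=
  ∀ H : Subgroup (TreeAut X), H ≤ G → H.FG →
    ⋂ n : ℕ, (H : Set (TreeAut X)) * (st G (level X n) : Set (TreeAut X)) = (H : Set (TreeAut X))

/-- The Grigorchuk--Nagnibeda alternative. -/
def GrigorchukNagnibedaAlternative (G : Subgroup (TreeAut X)) : Prop :=
  ∀ H : Subgroup (TreeAut X), H ≤ G → H.FG →
    (∃ y : List X, (psi y '' (H : Set (TreeAut X))).Finite) ∨
    ∃ Y : Set (List X), IsSpanningLeafSet Y ∧ IsInfraDirectProduct G Y (st H Y)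

end TreeAut

/-- A just infinite group: an infinite group all of whose proper quotients are finite. -/
def IsJustInfinite (Γ : Type*) [Group Γ] : Prop :=
  Infinite Γ ∧ ∀ N : Subgroup Γ, N.Normal → N ≠ ⊥ → Finite (Γ ⧸ N)

open scoped Classical in
/-- The Chabauty topology on the set of subgroups of a group: the topology induced by the product
topology on `{0,1}^Γ` through indicator functions. -/
noncomputable abbrev chabautyTopology (Γ : Type*) [Group Γ] : TopologicalSpace (Subgroup Γ) :=
  TopologicalSpace.induced (fun (H : Subgroup Γ) (g : Γ) => decide (g ∈ H))
    (inferInstance : TopologicalSpace (Γ → Bool))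

/-- The perfect kernel of the Chabauty space `Sub(Γ)`: what remains of the whole space after all
transfinite Cantor--Bendixson derivatives. -/
noncomputable def perfectKernelSub (Γ : Type*) [Group Γ] : Set (Subgroup Γ) :=
  @CantorBendixson.perfectKernel (Subgroup Γ) (chabautyTopology Γ) Set.univ

/-! Call a subgroup small if it has a finite section `ψ_y(H)`. The theorem follows from two facts:
the subgroups that are small or not finitely generated form a set without isolated points, and no
other subgroup survives in the perfect kernel.

If H is finitely generated and not small, the alternative makes some `st_H(Y)` an infra-direct
product. By Wilson's argument, normal subgroups of finite index in a just infinite group satisfy the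
ascending chain condition on their invariant subgroups. Applied one coordinate of Y at a time, this
stabilizes every chain above H (`chain_stabilizes_of_infinite_sections`). So all overgroups of H are
finitely generated, and a nearby subgroup, sharing the generators, is an overgroup; Noetherian
induction removes them all from the kernel.

Conversely, a small finitely generated H has words u, v of equal length in different orbits.
Adjoining copies of K along the orbit of v changes H, yet keeps the section at u finite; deep in the
tree the change is invisible on a given finite set (`exists_ne_of_finite_section`). If L is not
finitely generated, its finitely generated subgroups approximate it, and they are small by the chain
condition. -/

/-! ### Ascending chains in just infinite groups -/

theorem Monotone.exists_forall_ge_eq_of_finite {α : Type*} [PartialOrder α] [Finite α]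
    {f : ℕ → α} (hf : Monotone f) : ∃ n, ∀ m ≥ n, f m = f n := by
  obtain ⟨n, hn⟩ := WellFoundedGT.monotone_chain_condition (⟨f, hf⟩ : ℕ →o α)
  exact ⟨n, fun m hm => (hn m hm).symm⟩

namespace Subgroup

variable {Γ : Type*} [Group Γ]

/-- An ascending chain of subgroups stabilizes as soon as its trace on a finite index subgroup
does. -/
theorem chain_stabilizes_of_inf (M : Subgroup Γ) [M.FiniteIndex] {L : ℕ → Subgroup Γ}
    (hL : Monotone L) (h : ∃ n, ∀ m ≥ n, L m ⊓ M = L n ⊓ M) : ∃ n, ∀ m ≥ n, L m = L n := by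
  obtain ⟨n₁, h₁⟩ := h
  -- The cosets of M met by the chain also stabilize, the coset space being finite; trace and cosets
  -- together determine a subgroup in the chain.
  have hf : Monotone fun i => (QuotientGroup.mk : Γ → Γ ⧸ M) '' (L i : Set Γ) :=
    fun i j hij => Set.image_mono (hL hij)
  obtain ⟨n₂, h₂⟩ := hf.exists_forall_ge_eq_of_finite
  refine ⟨max n₁ n₂, fun m hm => le_antisymm (fun x hx => ?_) (hL hm)⟩
  have e : (QuotientGroup.mk : Γ → Γ ⧸ M) '' (L m : Set Γ) =
      (QuotientGroup.mk : Γ → Γ ⧸ M) '' (L (max n₁ n₂) : Set Γ) :=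
    (h₂ m (le_trans (le_max_right _ _) hm)).trans (h₂ _ (le_max_right _ _)).symm
  obtain ⟨z, hz, hzx⟩ : (x : Γ ⧸ M) ∈ (QuotientGroup.mk : Γ → Γ ⧸ M) '' (L (max n₁ n₂) : Set Γ) :=
    e ▸ ⟨x, hx, rfl⟩
  have hmem : z⁻¹ * x ∈ L m ⊓ M :=
    ⟨(L m).mul_mem ((L m).inv_mem (hL hm hz)) hx, QuotientGroup.eq.1 hzx⟩
  rw [h₁ m (le_trans (le_max_left _ _) hm), ← h₁ _ (le_max_left n₁ n₂)] at hmem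
  simpa using mul_mem hz hmem.1

theorem chain_stabilizes_of_le (M : Subgroup Γ) [M.FiniteIndex] {L : ℕ → Subgroup Γ}
    (hL : Monotone L) (h : ∀ i, M ≤ L i) : ∃ n, ∀ m ≥ n, L m = L n :=
  chain_stabilizes_of_inf M hL
    ⟨0, fun m _ => (inf_eq_right.2 (h m)).trans (inf_eq_right.2 (h 0)).symm⟩

/-- The elements of `C` all of whose conjugates by elements of `S` lie in `A`. -/
def conjInf (C : Subgroup Γ) (S : Finset Γ) (A : Subgroup Γ) : Subgroup Γ :=
  C ⊓ ⨅ s ∈ S, A.comap (MulAut.conj s).toMonoidHom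

theorem mem_conjInf {C : Subgroup Γ} {S : Finset Γ} {A : Subgroup Γ} {x : Γ} :
    x ∈ conjInf C S A ↔ x ∈ C ∧ ∀ s ∈ S, s * x * s⁻¹ ∈ A := by
  simp [conjInf, mem_inf, mem_iInf]

/-- `A` is contained in `C` and normalized by it. -/
def IsInvariantIn (C A : Subgroup Γ) : Prop :=
  A ≤ C ∧ ∀ c ∈ C, ∀ a ∈ A, c * a * c⁻¹ ∈ A

theorem IsInvariantIn.sup {C A B : Subgroup Γ} (hA : IsInvariantIn C A)
    (hB : IsInvariantIn C B) : IsInvariantIn C (A ⊔ B) := by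
  refine ⟨sup_le hA.1 hB.1, fun c hc a ha => ?_⟩
  have : A ⊔ B ≤ (A ⊔ B).comap (MulAut.conj c).toMonoidHom :=
    sup_le (fun x hx => le_sup_left (a := A) (hA.2 c hc x hx))
      (fun x hx => le_sup_right (a := A) (hB.2 c hc x hx))
  exact this ha

/-- Conjugating by s turns conjugation by c into conjugation by scs⁻¹, which is still in C. -/
theorem IsInvariantIn.conjInf {C A : Subgroup Γ} [C.Normal] (hA : IsInvariantIn C A)
    (S : Finset Γ) : IsInvariantIn C (conjInf C S A) := by
  refine ⟨inf_le_left, fun c hc a ha => ?_⟩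
  rw [mem_conjInf] at ha ⊢
  refine ⟨mul_mem (mul_mem hc ha.1) (inv_mem hc), fun s hs => ?_⟩
  have hsc : s * c * s⁻¹ ∈ C := Normal.conj_mem inferInstance c hc s
  have := hA.2 _ hsc _ (ha.2 s hs)
  convert this using 1
  group

theorem IsInvariantIn.comap_conj {C A : Subgroup Γ} [C.Normal] (hA : IsInvariantIn C A)
    (s : Γ) : IsInvariantIn C (A.comap (MulAut.conj s).toMonoidHom) := by
  refine ⟨fun x hx => ?_, fun c hc a ha => ?_⟩
  · have h1 : s * x * s⁻¹ ∈ C := hA.1 hx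
    have := Normal.conj_mem (H := C) inferInstance _ h1 s⁻¹
    convert this using 1
    group
  · have hsc : s * c * s⁻¹ ∈ C := Normal.conj_mem inferInstance c hc s
    have ha' : s * a * s⁻¹ ∈ A := ha
    have := hA.2 _ hsc _ ha'
    change s * (c * a * c⁻¹) * s⁻¹ ∈ A
    convert this using 1
    group

/-- A Dedekind-type law. -/
theorem IsInvariantIn.eq_of_sup_eq {C A B M : Subgroup Γ} (hA : IsInvariantIn C A)
    (hM : M ≤ C) (hAB : A ≤ B) (hsup : A ⊔ M = B ⊔ M) (hinf : ∀ x ∈ B, x ∈ M → x = 1) :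
    A = B := by
  refine le_antisymm hAB fun x hx => ?_
  have hn : M ≤ normalizer (A : Set Γ) := fun c hc =>
    mem_normalizer_iff.2 fun a => ⟨fun ha => hA.2 c (hM hc) a ha, fun ha => by
      have := hA.2 c⁻¹ (inv_mem (hM hc)) _ ha
      convert this using 1
      group⟩
  have hx' : x ∈ ((M ⊔ A : Subgroup Γ) : Set Γ) := by
    rw [sup_comm, hsup]; exact le_sup_left (a := B) hx
  rw [coe_mul_of_left_le_normalizer_right M A hn] at hx'
  obtain ⟨m, hm, a, ha, rfl⟩ := hx'
  have hmB : m ∈ B := by simpa using mul_mem hx (inv_mem (hAB ha))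
  change m * a ∈ A
  rw [hinf m hmB hm, one_mul]
  exact ha

/-- The inductive step of Wilson's theorem on the maximal condition for normal subgroups. -/
theorem not_strictMono_of_conjInf_eq_bot {C : Subgroup Γ} [C.Normal] (hC : C ≠ ⊥) (S : Finset Γ)
    (hS : ∀ N : ℕ → Subgroup Γ, StrictMono N → (∀ i, IsInvariantIn C (N i)) →
      ∀ i, conjInf C S (N i) = ⊥)
    (N : ℕ → Subgroup Γ) (hN : ∀ i, IsInvariantIn C (N i)) : ¬ StrictMono N := by
  classical
  induction S using Finset.induction_on generalizing N with
  | empty =>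
    intro hmono
    exact hC (by simpa [conjInf] using hS N hmono hN 0)
  | insert s Y _ ih =>
    refine ih (fun N' hmono hN' j => ?_) N hN
    by_contra hM
    have hinv := (hN' j).conjInf Y
    set M := conjInf C Y (N' j) with hMdef
    have hinv' := hinv.comap_conj s⁻¹
    set M' := M.comap (MulAut.conj s⁻¹).toMonoidHom with hM'def
    -- Here M' = sMs⁻¹ meets each later term trivially: a common element x gives s⁻¹xs in the
    -- trivial `conjInf` for `insert s Y`. The Dedekind law then keeps the enlarged chain strict.
    have hL : StrictMono fun i => N' (j + i) ⊔ M' := by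
      refine strictMono_nat_of_lt_succ fun i => lt_of_le_of_ne
        (sup_le_sup_right (hmono.monotone (by lia)) _) fun he => ?_
      refine (hmono (show j + i < j + (i + 1) by lia)).ne
        ((hN' _).eq_of_sup_eq hinv'.1 (hmono.monotone (by lia)) he fun x hx hxM => ?_)
      have hxM' : s⁻¹ * x * s ∈ M := by simpa [hM'def] using hxM
      have hmem : s⁻¹ * x * s ∈ conjInf C (insert s Y) (N' (j + (i + 1))) := by
        rw [hMdef, mem_conjInf] at hxM'
        refine mem_conjInf.2 ⟨hxM'.1, fun t ht => ?_⟩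
        rcases Finset.mem_insert.1 ht with rfl | ht
        · convert hx using 1
          group
        · exact hmono.monotone (by lia) (hxM'.2 t ht)
      rw [hS N' hmono hN', mem_bot] at hmem
      have : x = s * (s⁻¹ * x * s) * s⁻¹ := by group
      rw [this, hmem]; simp
    -- The hypothesis applies to the enlarged chain, whose first `conjInf` contains M.
    have hbot := hS _ hL (fun i => (hN' _).sup hinv') 0
    refine hM (eq_bot_iff.2 (hbot ▸ fun m hm => mem_conjInf.2 ⟨hinv.1 hm, fun t ht => ?_⟩))
    rcases Finset.mem_insert.1 ht with rfl | ht
    · refine le_sup_right (a := N' (j + 0)) ?_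
      change t⁻¹ * (t * m * t⁻¹) * t⁻¹⁻¹ ∈ M
      convert hm using 1
      group
    · exact le_sup_left (b := M') ((mem_conjInf.1 hm).2 t ht)

end Subgroup

open Subgroup in
/-- The maximal condition for normal subgroups passes from a just infinite group to its normal
subgroups of finite index. -/
theorem IsJustInfinite.invariant_chain_stabilizes {Γ : Type*} [Group Γ] (hΓ : IsJustInfinite Γ)
    (C : Subgroup Γ) [C.Normal] [C.FiniteIndex] {N : ℕ → Subgroup Γ} (hmono : Monotone N)
    (hN : ∀ i, IsInvariantIn C (N i)) : ∃ n, ∀ m ≥ n, N m = N n := by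
  classical
  have := hΓ.1
  have hC : C ≠ ⊥ := by
    rintro rfl
    have : Finite Γ := (QuotientGroup.quotientBot (G := Γ)).toEquiv.finite_iff.1 inferInstance
    exact not_finite Γ
  have key : ∀ N : ℕ → Subgroup Γ, (∀ i, IsInvariantIn C (N i)) → ¬ StrictMono N := by
    have hfin : Finite (Γ ⧸ C) := inferInstance
    have hT : (Set.range (Quotient.out : Γ ⧸ C → Γ)).Finite := Set.finite_range _
    -- Take S to be a transversal of C. Since `N i` is C-invariant, testing conjugates on S tests
    -- them all, so a nontrivial `conjInf` would give `N i` a nontrivial normal core, of finite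
    -- index.
    refine not_strictMono_of_conjInf_eq_bot hC hT.toFinset fun N hmono hN i => ?_
    by_contra hne
    set I := conjInf C hT.toFinset (N i) with hI
    have hIcore : I ≤ (N i).normalCore := by
      intro x hx g
      obtain ⟨hxC, hx⟩ := mem_conjInf.1 hx
      have h1 := hx _ (hT.mem_toFinset.2 ⟨(g : Γ ⧸ C), rfl⟩)
      obtain ⟨c, hc⟩ := QuotientGroup.mk_out_eq_mul C g
      rw [hc] at h1
      have hc' : g * c * g⁻¹ ∈ C := Normal.conj_mem inferInstance _ c.2 g
      have := (hN i).2 _ (inv_mem hc') _ h1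
      convert this using 1
      group
    have hcore : (N i).normalCore ≠ ⊥ := fun h => hne (eq_bot_iff.2 (h ▸ hIcore))
    have : Finite (Γ ⧸ (N i).normalCore) := hΓ.2 _ inferInstance hcore
    have : (N i).normalCore.FiniteIndex := Subgroup.finiteIndex_of_finite_quotient
    obtain ⟨n, hn⟩ := chain_stabilizes_of_le (N i).normalCore
      (L := fun k => N (i + k)) (fun a b hab => hmono.monotone (by lia))
      (fun k => (normalCore_le _).trans (hmono.monotone (by lia)))
    exact (hmono (show i + n < i + (n + 1) by lia)).ne (hn (n + 1) (by lia)).symm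
  by_contra! hcon
  choose! k hk hk' using hcon
  -- Iterating k extracts a strictly increasing subsequence.
  refine key (fun i => N (k^[i] 0)) (fun i => hN _) (strictMono_nat_of_lt_succ fun i => ?_)
  rw [Function.iterate_succ_apply']
  exact lt_of_le_of_ne (hmono (hk _)) (hk' _).symm

open Subgroup in
/-- Ascending chains of subgroups normalized by a finite index subgroup of a just infinite group
stabilize. -/
theorem IsJustInfinite.normalized_chain_stabilizes {Γ : Type*} [Group Γ] (hΓ : IsJustInfinite Γ)
    (B : Subgroup Γ) [B.FiniteIndex] {N : ℕ → Subgroup Γ} (hmono : Monotone N)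
    (hN : ∀ i, ∀ b ∈ B, ∀ a ∈ N i, b * a * b⁻¹ ∈ N i) : ∃ n, ∀ m ≥ n, N m = N n := by
  refine chain_stabilizes_of_inf B.normalCore hmono ?_
  refine hΓ.invariant_chain_stabilizes B.normalCore
    (fun i j hij => inf_le_inf_right _ (hmono hij)) fun i => ⟨inf_le_right, fun c hc a ha => ⟨?_, ?_⟩⟩
  · exact hN i c (normalCore_le B hc) a ha.1
  · exact Normal.conj_mem inferInstance a ha.2 c

/-! ### The perfect kernel of the Chabauty space -/

section Chabauty

variable {Γ : Type*} [Group Γ]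

/-- Accumulation points in the Chabauty space, in terms of finite sets of group elements. -/
theorem chabauty_accPt_iff {H : Subgroup Γ} {C : Set (Subgroup Γ)} :
    @AccPt (Subgroup Γ) (chabautyTopology Γ) H (Filter.principal C) ↔
      ∀ F : Set Γ, F.Finite → ∃ L ∈ C, L ≠ H ∧ ∀ g ∈ F, (g ∈ L ↔ g ∈ H) := by
  classical
  let _ := chabautyTopology Γ
  rw [accPt_iff_nhds]
  constructor
  · intro h F hF
    obtain ⟨L, ⟨hLU, hLC⟩, hne⟩ := h {L | ∀ g ∈ F, (g ∈ L ↔ g ∈ H)} (by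
      rw [nhds_induced, Filter.mem_comap]
      refine ⟨F.pi fun g => {decide (g ∈ H)}, ?_, fun L hL g hg => ?_⟩
      · exact set_pi_mem_nhds hF fun g _ => by simp
      · have := hL g hg
        simpa using this)
    exact ⟨L, hLC, hne, hLU⟩
  · intro h U hU
    rw [nhds_induced, Filter.mem_comap] at hU
    obtain ⟨t, ht, htU⟩ := hU
    rw [nhds_pi, Filter.mem_pi] at ht
    obtain ⟨F, hF, s, hs, hst⟩ := ht
    obtain ⟨L, hLC, hne, hL⟩ := h F hF
    refine ⟨L, ⟨htU (hst fun g hg => ?_), hLC⟩, hne⟩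
    have e : decide (g ∈ L) = decide (g ∈ H) := by simp [hL g hg]
    have := mem_of_mem_nhds (hs g)
    change decide (g ∈ L) ∈ s g
    rw [e]
    exact this

/-- S need not be closed: its own derivatives are constant, and derivation is monotone. -/
theorem subset_perfectKernelSub {S : Set (Subgroup Γ)}
    (hS : ∀ H ∈ S, ∀ F : Set Γ, F.Finite → ∃ L ∈ S, L ≠ H ∧ ∀ g ∈ F, (g ∈ L ↔ g ∈ H)) :
    S ⊆ perfectKernelSub Γ := by
  let _ := chabautyTopology Γ
  have hpre : Preperfect S := fun H hH => chabauty_accPt_iff.2 (hS H hH)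
  refine Set.subset_iInter fun a => ?_
  rw [← CantorBendixson.iteratedDerivedSet_constant_iff_preperfect.1 hpre a]
  exact CantorBendixson.iteratedDerivedSet_mono (Set.subset_univ S) a

theorem exists_ne_mem_perfectKernelSub {H : Subgroup Γ} (hH : H ∈ perfectKernelSub Γ)
    {F : Set Γ} (hF : F.Finite) :
    ∃ L ∈ perfectKernelSub Γ, L ≠ H ∧ ∀ g ∈ F, (g ∈ L ↔ g ∈ H) := by
  let _ := chabautyTopology Γ
  exact chabauty_accPt_iff.1
    ((CantorBendixson.perfect_perfectKernel isClosed_univ).acc H hH) F hF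

theorem wellFoundedGT_Ici_of_chain_stabilizes {H : Subgroup Γ}
    (hchain : ∀ L : ℕ → Subgroup Γ, Monotone L → (∀ i, H ≤ L i) → ∃ n, ∀ m ≥ n, L m = L n) :
    WellFoundedGT (Set.Ici H) := by
  rw [wellFoundedGT_iff_monotone_chain_condition]
  intro a
  obtain ⟨n, hn⟩ := hchain (fun i => (a i).1) (fun i j hij => a.monotone hij) (fun i => (a i).2)
  exact ⟨n, fun m hm => Subtype.ext (hn m hm).symm⟩

/-- A maximal finitely generated subgroup between H and L absorbs every element of L. -/
theorem Subgroup.FG.of_le_of_chain_stabilizes {H : Subgroup Γ} (hH : H.FG)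
    (hchain : ∀ L : ℕ → Subgroup Γ, Monotone L → (∀ i, H ≤ L i) → ∃ n, ∀ m ≥ n, L m = L n)
    {L : Subgroup Γ} (hHL : H ≤ L) : L.FG := by
  have := wellFoundedGT_Ici_of_chain_stabilizes hchain
  obtain ⟨⟨A, hHA⟩, ⟨hA, hAL⟩, hmax⟩ := WellFounded.has_min (wellFounded_gt (α := Set.Ici H))
    {A | A.1.FG ∧ A.1 ≤ L} ⟨⟨H, Set.self_mem_Ici⟩, hH, hHL⟩
  convert hA
  refine le_antisymm (fun x hx => ?_) hAL
  by_contra hxA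
  have hle : A ≤ A ⊔ Subgroup.zpowers x := le_sup_left
  refine hmax ⟨A ⊔ Subgroup.zpowers x, le_trans hHA hle⟩
    ⟨hA.sup ⟨{x}, by simp [Subgroup.zpowers_eq_closure]⟩, sup_le hAL (by simpa using hx)⟩ ?_
  refine lt_of_le_of_ne hle fun he => hxA ?_
  have e : A = A ⊔ Subgroup.zpowers x := congrArg Subtype.val he
  exact e.ge (le_sup_right (a := A) (Subgroup.mem_zpowers x))

theorem notMem_perfectKernelSub_of_chain_stabilizes {H : Subgroup Γ} (hH : H.FG)
    (hchain : ∀ L : ℕ → Subgroup Γ, Monotone L → (∀ i, H ≤ L i) → ∃ n, ∀ m ≥ n, L m = L n) :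
    H ∉ perfectKernelSub Γ := by
  have := wellFoundedGT_Ici_of_chain_stabilizes hchain
  have key : ∀ L : Set.Ici H, L.1 ∉ perfectKernelSub Γ := by
    intro L
    -- A kernel point near L that agrees with it on a finite generating set is a strictly larger
    -- subgroup.
    induction L using (wellFounded_gt (α := Set.Ici H)).induction with
    | _ L ih =>
      intro hL
      obtain ⟨s, hs⟩ := hH.of_le_of_chain_stabilizes hchain L.2
      obtain ⟨L', hL', hne, hmem⟩ := exists_ne_mem_perfectKernelSub hL s.finite_toSet
      have hle : L.1 ≤ L' := by
        rw [← hs, Subgroup.closure_le]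
        intro g hg
        exact (hmem g hg).2 (hs ▸ Subgroup.subset_closure hg)
      exact ih ⟨L', le_trans L.2 hle⟩ (lt_of_le_of_ne hle fun h => hne (congrArg Subtype.val h).symm)
        hL'
  exact key ⟨H, Set.self_mem_Ici⟩

end Chabauty

/-! ### Lengths, sections and copies in the tree -/

namespace TreeAut

variable {X : Type*}

/-- Strict chains of prefixes map to strict chains; the inverse then gives equality of lengths. -/
theorem length_le_length_apply (g : TreeAut X) (u : List X) : u.length ≤ (g u).length := by
  induction u using List.reverseRecOn with
  | nil => simp
  | append_singleton v x ih =>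
    have hp : g v <+: g (v ++ [x]) := g.map_prefix (List.prefix_append v [x])
    have hne : (g v).length ≠ (g (v ++ [x])).length := fun h => by
      have := g.injective (hp.eq_of_length h)
      simp at this
    have := hp.length_le
    simp only [List.length_append, List.length_singleton]
    lia

@[simp]
theorem length_apply (g : TreeAut X) (u : List X) : (g u).length = u.length := by
  refine le_antisymm ?_ (length_le_length_apply g u)
  simpa using length_le_length_apply g.symm (g u)

theorem apply_eq_of_append_apply_eq (g : TreeAut X) {u w : List X} (h : g (u ++ w) = u ++ w) :
    g u = u := by
  rw [apply_append] at h
  exact (List.append_inj h (length_apply g u)).1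

theorem psi_append (u w : List X) (g : TreeAut X) : psi (u ++ w) g = psi w (psi u g) := by
  ext1 t
  apply List.append_cancel_left (as := g (u ++ w))
  rw [← apply_append, List.append_assoc, apply_append g u (w ++ t), apply_append (psi u g),
    apply_append g u w, List.append_assoc]

theorem psi_inv_apply (u : List X) (g : TreeAut X) : psi (g u) g⁻¹ = (psi u g)⁻¹ := by
  have e := psi_mul u g⁻¹ g
  rw [inv_mul_cancel, psi_one] at e
  exact eq_inv_of_mul_eq_one_left e.symm

theorem mem_st {G : Subgroup (TreeAut X)} {Y : Set (List X)} {g : TreeAut X} :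
    g ∈ st G Y ↔ g ∈ G ∧ ∀ y ∈ Y, g y = y := by
  simp [st, Subgroup.mem_inf, Subgroup.mem_iInf, MulAction.mem_stabilizer_iff]

theorem mem_map_psiHom {A : Subgroup (TreeAut X)} {y : List X} {b : TreeAut X} :
    b ∈ (A.subgroupOf (MulAction.stabilizer (TreeAut X) y)).map (psiHom y) ↔
      ∃ a ∈ A, a y = y ∧ psi y a = b := by
  constructor
  · rintro ⟨a, ha, rfl⟩
    exact ⟨a.1, ha, a.2, rfl⟩
  · rintro ⟨a, ha, hy, rfl⟩
    exact ⟨⟨a, hy⟩, ha, rfl⟩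

open scoped Classical in
/-- The automorphism acting as `k` below `v` and fixing every word that is not below `v`. -/
noncomputable def below (v : List X) (k : TreeAut X) : TreeAut X where
  toFun w := if v <+: w then v ++ k (w.drop v.length) else w
  invFun w := if v <+: w then v ++ k.symm (w.drop v.length) else w
  left_inv w := by
    by_cases h : v <+: w
    · obtain ⟨t, rfl⟩ := h
      simp
    · simp [h]
  right_inv w := by
    by_cases h : v <+: w
    · obtain ⟨t, rfl⟩ := h
      simp
    · simp [h]
  map_rel_iff' := by
    intro a b
    simp only [Equiv.coe_fn_mk]
    by_cases ha : v <+: a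
    · obtain ⟨s, rfl⟩ := ha
      by_cases hb : v <+: b
      · obtain ⟨t, rfl⟩ := hb
        simp [List.prefix_append_right_inj, k.map_rel_iff]
      · have h1 : ∀ s : List X, ¬ (v ++ s) <+: b := fun s h =>
          hb ((List.prefix_append v s).trans h)
        simp [hb, h1]
    · by_cases hb : v <+: b
      · obtain ⟨t, rfl⟩ := hb
        have h1 : ∀ t : List X, a <+: v ++ t ↔ a <+: v := fun t =>
          ⟨fun h => (List.prefix_or_prefix_of_prefix h (List.prefix_append v t)).resolve_right ha,
            fun h => h.trans (List.prefix_append v t)⟩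
        simp [ha, h1]
      · simp [ha, hb]

theorem below_apply_append (v : List X) (k : TreeAut X) (w : List X) :
    below v k (v ++ w) = v ++ k w := by
  simp [below]

theorem below_apply_of_not_prefix {v w : List X} (k : TreeAut X) (h : ¬ v <+: w) :
    below v k w = w := by
  simp [below, h]

theorem apply_nil (g : TreeAut X) : g [] = [] :=
  List.length_eq_zero_iff.1 (by simp)

theorem below_apply_self (v : List X) (k : TreeAut X) : below v k v = v := by
  simpa [apply_nil] using below_apply_append v k []

theorem psi_below (v : List X) (k : TreeAut X) : psi v (below v k) = k := by
  ext1 w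
  apply List.append_cancel_left (as := below v k v)
  rw [← apply_append, below_apply_append, below_apply_self]

theorem eq_of_prefix_append {u v w : List X} (hl : u.length = v.length) (h : v <+: u ++ w) :
    v = u :=
  (List.prefix_of_prefix_length_le h (List.prefix_append u w) hl.ge).eq_of_length hl.symm

theorem psi_eq_one_of_forall {g : TreeAut X} {u : List X} (h : ∀ w, g (u ++ w) = u ++ w) :
    psi u g = 1 := by
  ext1 w
  have hu : g u = u := by simpa using h []
  apply List.append_cancel_left (as := g u)
  rw [← apply_append, h, hu]
  rfl

theorem below_mem_copies {K : Subgroup (TreeAut X)} {n : ℕ} {Y : Set (List X)}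
    (hY : Y ⊆ level X n) {v : List X} (hv : v ∈ Y) {k : TreeAut X} (hk : k ∈ K) :
    below v k ∈ copies K Y := by
  refine ⟨fun y hy => ?_, fun w hw => below_apply_of_not_prefix k (hw v hv)⟩
  rcases eq_or_ne v y with rfl | hne
  · exact ⟨below_apply_self v k, by rwa [psi_below]⟩
  · have h : ∀ w, below v k (y ++ w) = y ++ w := fun w =>
      below_apply_of_not_prefix k fun hp =>
        hne (eq_of_prefix_append ((hY hy).trans (hY hv).symm) hp)
    exact ⟨by simpa using h [], by rw [psi_eq_one_of_forall h]; exact K.one_mem⟩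

theorem psi_eq_one_of_mem_copies {K : Subgroup (TreeAut X)} {n : ℕ} {Y : Set (List X)}
    (hY : Y ⊆ level X n) {u : List X} (hu : u ∈ level X n) (huY : u ∉ Y) {g : TreeAut X}
    (hg : g ∈ copies K Y) : g u = u ∧ psi u g = 1 := by
  have h : ∀ w, g (u ++ w) = u ++ w := fun w => hg.2 _ fun y hy hp =>
    huY (eq_of_prefix_append (hu.trans (hY hy).symm) hp ▸ hy)
  exact ⟨by simpa using h [], psi_eq_one_of_forall h⟩

theorem copies_le_copies_level {K : Subgroup (TreeAut X)} {n : ℕ} {Y : Set (List X)}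
    (hY : Y ⊆ level X n) : copies K Y ≤ copies K (level X n) := by
  intro g hg
  refine ⟨fun u hu => ?_, fun w hw => hg.2 w fun y hy => hw y (hY hy)⟩
  by_cases huY : u ∈ Y
  · exact hg.1 u huY
  · obtain ⟨h1, h2⟩ := psi_eq_one_of_mem_copies hY hu huY hg
    exact ⟨h1, h2 ▸ K.one_mem⟩

/-- Conjugation by an automorphism whose sections normalize `K` preserves the group of copies
of `K` at an invariant set of words. -/
theorem conj_mem_copies {K : Subgroup (TreeAut X)} {Y : Set (List X)} {h g : TreeAut X}
    (hY : ∀ y, h y ∈ Y ↔ y ∈ Y)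
    (hK : ∀ y : List X, ∀ k ∈ K, psi y h * k * (psi y h)⁻¹ ∈ K) (hg : g ∈ copies K Y) :
    h * g * h⁻¹ ∈ copies K Y := by
  have hself : ∀ w, h (h⁻¹ w) = w := fun w => RelIso.apply_inv_self h w
  refine ⟨fun y hy => ?_, fun w hw => ?_⟩
  · obtain ⟨h1, h2⟩ := hg.1 (h⁻¹ y) ((hY _).1 (by rwa [hself]))
    refine ⟨by rw [RelIso.mul_apply, RelIso.mul_apply, h1, hself], ?_⟩
    have e : psi y h⁻¹ = (psi (h⁻¹ y) h)⁻¹ := by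
      rw [← psi_inv_apply, hself]
    rw [psi_mul, psi_mul, h1, e]
    exact hK _ _ h2
  · have := hg.2 (h⁻¹ w) fun y hy hp => ?_
    · rw [RelIso.mul_apply, RelIso.mul_apply, this, hself]
    · exact hw _ ((hY y).2 hy) (by simpa [hself] using h.map_prefix hp)

theorem finite_level [Finite X] (n : ℕ) : (level X n).Finite :=
  List.finite_length_eq X n

theorem eq_one_of_subsingleton [Subsingleton X] (g : TreeAut X) : g = 1 := by
  ext1 w
  refine List.ext_getElem (by simp) fun i _ _ => Subsingleton.elim _ _

theorem nontrivial_of_infinite {G : Subgroup (TreeAut X)} [Infinite G] : Nontrivial X := by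
  by_contra h
  rw [not_nontrivial_iff_subsingleton] at h
  have : Subsingleton G := ⟨fun a b => Subtype.ext (by
    rw [eq_one_of_subsingleton a.1, eq_one_of_subsingleton b.1])⟩
  exact not_finite G

theorem lt_ncard_level [Finite X] [Nontrivial X] (n : ℕ) : n < (level X n).ncard := by
  classical
  have := Fintype.ofFinite X
  have e : (level X n).ncard = Fintype.card X ^ n := by
    rw [← card_vector, ← Nat.card_eq_fintype_card]
    rfl
  rw [e]
  exact Nat.lt_pow_self Fintype.one_lt_card

theorem st_level_antitone [Nonempty X] (G : Subgroup (TreeAut X)) :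
    Antitone fun n => st G (level X n) := by
  intro m n hmn g hg
  rw [mem_st] at hg ⊢
  obtain ⟨a⟩ := ‹Nonempty X›
  -- Pad u to length n; fixing the padded word fixes its prefix.
  refine ⟨hg.1, fun u hu => apply_eq_of_append_apply_eq g (w := List.replicate (n - m) a)
    (hg.2 _ ?_)⟩
  have hu' : u.length = m := hu
  simp [level, hu', hmn]

instance finiteIndex_stabilizer [Finite X] (u : List X) :
    (MulAction.stabilizer (TreeAut X) u).FiniteIndex := by
  have hfin : (MulAction.orbit (TreeAut X) u).Finite :=
    (finite_level u.length).subset (by rintro _ ⟨g, rfl⟩; exact length_apply g u)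
  refine ⟨?_⟩
  rw [MulAction.index_stabilizer]
  exact (Set.ncard_pos hfin).2 ⟨u, MulAction.mem_orbit_self u⟩ |>.ne'

end TreeAut

theorem Subgroup.fg_map_subtype_iff {Γ : Type*} [Group Γ] {G : Subgroup Γ} (A : Subgroup G) :
    (A.map G.subtype).FG ↔ A.FG := by
  rw [← Group.fg_iff_subgroup_fg, ← Group.fg_iff_subgroup_fg]
  let e := A.equivMapOfInjective G.subtype G.subtype_injective
  exact ⟨fun h => Group.fg_of_surjective (f := e.symm.toMonoidHom) e.symm.surjective,
    fun h => Group.fg_of_surjective (f := e.toMonoidHom) e.surjective⟩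

/-! ### The chain condition above an infra-direct product -/

namespace TreeAut

variable {X : Type*}

/-- The automorphisms that fix every `t ∈ T` and have trivial sections there. -/
def trivialSections (T : Finset (List X)) : Subgroup (TreeAut X) :=
  ⨅ t ∈ T, (psiHom t).ker.map (MulAction.stabilizer (TreeAut X) t).subtype

theorem mem_trivialSections {T : Finset (List X)} {a : TreeAut X} :
    a ∈ trivialSections T ↔ ∀ t ∈ T, a t = t ∧ psi t a = 1 := by
  simp only [trivialSections, Subgroup.mem_iInf]
  refine forall₂_congr fun t _ => ⟨?_, fun h => ⟨⟨a, h.1⟩, h.2, rfl⟩⟩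
  rintro ⟨b, hb, rfl⟩
  exact ⟨b.2, hb⟩

theorem psi_inv_of_fixed {y : List X} {b : TreeAut X} (hb : b y = y) :
    psi y b⁻¹ = (psi y b)⁻¹ := by
  have := psi_inv_apply y b
  rwa [hb] at this

theorem psi_inv_mul_of_fixed {y : List X} {a b : TreeAut X} (ha : a y = y) (hb : b y = y) :
    psi y (b⁻¹ * a) = (psi y b)⁻¹ * psi y a := by
  rw [psi_mul, ha, psi_inv_of_fixed hb]

theorem inv_apply_of_fixed {y : List X} {b : TreeAut X} (hb : b y = y) : b⁻¹ y = y := by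
  conv_lhs => rw [← hb]
  exact RelIso.inv_apply_self b y

/-- An ascending chain of groups fixing a finite set `T` of words, whose projections to each
coordinate in `T` have finite index in the just infinite group `G`, stabilizes on `T`. -/
theorem exists_psi_eq_of_chain {G : Subgroup (TreeAut X)} (hji : IsJustInfinite G)
    {A : ℕ → Subgroup (TreeAut X)} (hA : Monotone A) (T : Finset (List X))
    (hfix : ∀ y ∈ T, ∀ i, ∀ a ∈ A i, a y = y) (hG : ∀ y ∈ T, ∀ i, ∀ a ∈ A i, psi y a ∈ G)
    (hidx : ∀ y ∈ T, ((((A 0).subgroupOf (MulAction.stabilizer (TreeAut X) y)).map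
      (psiHom y)).subgroupOf G).FiniteIndex) :
    ∃ n, ∀ m ≥ n, ∀ a ∈ A m, ∃ b ∈ A n, ∀ y ∈ T, psi y a = psi y b := by
  classical
  induction T using Finset.induction_on with
  | empty => exact ⟨0, fun m _ a _ => ⟨1, one_mem _, by simp⟩⟩
  | insert y T _ ih =>
    obtain ⟨n₁, h₁⟩ := ih (fun t ht => hfix t (Finset.mem_insert_of_mem ht))
      (fun t ht => hG t (Finset.mem_insert_of_mem ht))
      (fun t ht => hidx t (Finset.mem_insert_of_mem ht))
    have hy := Finset.mem_insert_self y T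
    have := hidx y hy
    let B : Subgroup G := (((A 0).subgroupOf (MulAction.stabilizer (TreeAut X) y)).map
      (psiHom y)).subgroupOf G
    -- The sections at y of the elements trivial on T; lifting B to `A 0` shows that B normalizes
    -- them.
    let N : ℕ → Subgroup G := fun i =>
      (((A i ⊓ trivialSections T).subgroupOf (MulAction.stabilizer (TreeAut X) y)).map
        (psiHom y)).subgroupOf G
    have hN : ∀ i (x : G), x ∈ N i ↔ ∃ a ∈ A i ⊓ trivialSections T, a y = y ∧ psi y a = x :=
      fun i x => mem_map_psiHom
    obtain ⟨n₂, h₂⟩ := hji.normalized_chain_stabilizes B (N := N)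
      (fun i j hij x hx => by
        obtain ⟨a, ha, hay⟩ := (hN i x).1 hx
        exact (hN j x).2 ⟨a, ⟨hA hij ha.1, ha.2⟩, hay⟩)
      (fun i b hb x hx => by
        obtain ⟨c, hc, hcy, hcb⟩ := (mem_map_psiHom (A := A 0) (y := y)).1 hb
        obtain ⟨a, ha, hay, hax⟩ := (hN i x).1 hx
        have hci := hA (Nat.zero_le i) hc
        refine (hN i _).2 ⟨c * a * c⁻¹, ⟨(A i).mul_mem ((A i).mul_mem hci ha.1) ((A i).inv_mem hci),
          mem_trivialSections.2 fun t ht => ?_⟩, ?_, ?_⟩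
        · have hct := hfix t (Finset.mem_insert_of_mem ht) 0 c hc
          obtain ⟨hat, hat'⟩ := mem_trivialSections.1 ha.2 t ht
          refine ⟨by simp [RelIso.mul_apply, inv_apply_of_fixed hct, hat, hct], ?_⟩
          rw [psi_mul, psi_mul, inv_apply_of_fixed hct, hat, hat', mul_one,
            psi_inv_of_fixed hct, mul_inv_cancel]
        · simp [RelIso.mul_apply, inv_apply_of_fixed hcy, hay, hcy]
        · rw [psi_mul, psi_mul, inv_apply_of_fixed hcy, hay, psi_inv_of_fixed hcy, hcb, hax]
          rfl)
    refine ⟨max n₁ n₂, fun m hm a ha => ?_⟩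
    obtain ⟨b, hb, hab⟩ := h₁ m (le_trans (le_max_left _ _) hm) a ha
    have hbm : b ∈ A m := hA (le_trans (le_max_left _ _) hm) hb
    have hk : b⁻¹ * a ∈ A m := mul_mem (inv_mem hbm) ha
    have hkT : b⁻¹ * a ∈ trivialSections T := mem_trivialSections.2 fun t ht => by
      have ht' := Finset.mem_insert_of_mem (b := y) ht
      refine ⟨hfix t ht' m _ hk, ?_⟩
      rw [psi_inv_mul_of_fixed (hfix t ht' m a ha) (hfix t ht' m b hbm), hab t ht, inv_mul_cancel]
    have hmem : (⟨psi y (b⁻¹ * a), hG y hy m _ hk⟩ : G) ∈ N m :=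
      (hN m _).2 ⟨_, ⟨hk, hkT⟩, hfix y hy m _ hk, rfl⟩
    rw [h₂ m (le_trans (le_max_right _ _) hm), ← h₂ _ (le_max_right n₁ n₂)] at hmem
    obtain ⟨c, hc, hcy, hck⟩ := (hN _ _).1 hmem
    change psi y c = psi y (b⁻¹ * a) at hck
    -- b is right on T; c repairs the coordinate y without disturbing T.
    refine ⟨b * c, mul_mem (hA (le_max_left _ _) hb) hc.1, fun t ht => ?_⟩
    rcases Finset.mem_insert.1 ht with rfl | ht
    · rw [psi_mul, hcy, hck, psi_inv_mul_of_fixed (hfix t hy m a ha) (hfix t hy m b hbm),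
        mul_inv_cancel_left]
    · obtain ⟨hct, hct'⟩ := mem_trivialSections.1 hc.2 t ht
      rw [psi_mul, hct, hct', mul_one, hab t ht]

/-- Every word extends to one with a prefix in Y, where the data at Y decide its image. -/
theorem eq_of_psi_eq [Nonempty X] {Y : Set (List X)} (hY : IsSpanningLeafSet Y)
    {a b : TreeAut X} (h : ∀ y ∈ Y, a y = b y ∧ psi y a = psi y b) : a = b := by
  obtain ⟨-, N, hN⟩ := hY
  obtain ⟨x⟩ := ‹Nonempty X›
  ext1 u
  obtain ⟨y, hy, t, ht⟩ := hN (u ++ List.replicate N x) (by simp)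
  have e : a (u ++ List.replicate N x) = b (u ++ List.replicate N x) := by
    rw [← ht, apply_append, apply_append, (h y hy).1, (h y hy).2]
  rw [apply_append, apply_append] at e
  exact (List.append_inj e (by simp)).1

/-- Stabilizing the finite set Y costs only finite index, and the projections of larger groups
inherit finite index from H. -/
theorem chain_stabilizes_of_isInfraDirectProduct [Finite X] [Nonempty X]
    {G : Subgroup (TreeAut X)} (hji : IsJustInfinite G) (hss : IsSelfSimilar G)
    {Y : Set (List X)} (hY : IsSpanningLeafSet Y) {H : Subgroup (TreeAut X)}
    (hHY : IsInfraDirectProduct G Y (st H Y)) {L : ℕ → Subgroup (TreeAut X)} (hL : Monotone L)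
    (hHL : ∀ i, H ≤ L i) (hLG : ∀ i, L i ≤ G) : ∃ n, ∀ m ≥ n, L m = L n := by
  have hfin : Finite Y := hY.1.1
  have hst : ∀ A : Subgroup (TreeAut X), st A Y =
      A ⊓ ⨅ y : Y, MulAction.stabilizer (TreeAut X) (y : List X) := fun A => by
    rw [st, iInf_subtype']
  have : (⨅ y : Y, MulAction.stabilizer (TreeAut X) (y : List X)).FiniteIndex :=
    Subgroup.finiteIndex_iInf fun y => inferInstance
  refine Subgroup.chain_stabilizes_of_inf
    (⨅ y : Y, MulAction.stabilizer (TreeAut X) (y : List X)) hL ?_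
  simp only [← hst]
  have hmono : Monotone fun i => st (L i) Y := fun i j hij => inf_le_inf_right _ (hL hij)
  obtain ⟨n, hn⟩ := exists_psi_eq_of_chain hji hmono hY.1.1.toFinset
    (fun y hy i a ha => (mem_st.1 ha).2 y (by simpa using hy))
    (fun y _ i a ha => hss a (hLG i (mem_st.1 ha).1) y)
    (fun y hy => by
      obtain ⟨-, h⟩ := hHY.2 y (by simpa using hy)
      have := h.to_finiteIndex_subgroupOf
      have hle : (((st H Y).subgroupOf (MulAction.stabilizer (TreeAut X) y)).map
          (psiHom y)).subgroupOf G ≤ (((st (L 0) Y).subgroupOf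
            (MulAction.stabilizer (TreeAut X) y)).map (psiHom y)).subgroupOf G :=
        Subgroup.comap_mono (Subgroup.map_mono
          (Subgroup.comap_mono (inf_le_inf_right _ (hHL 0))))
      exact Subgroup.finiteIndex_of_le hle)
  refine ⟨n, fun m hm => le_antisymm (fun a ha => ?_) (hmono hm)⟩
  obtain ⟨b, hb, hab⟩ := hn m hm a ha
  have : a = b := eq_of_psi_eq hY fun y hy => ⟨by
    rw [(mem_st.1 ha).2 y hy, (mem_st.1 hb).2 y hy], hab y (by simpa using hy)⟩
  exact this ▸ hb

theorem chain_stabilizes_of_infinite_sections [Finite X] {G : Subgroup (TreeAut X)}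
    (hji : IsJustInfinite G) (hss : IsSelfSimilar G) (hGN : GrigorchukNagnibedaAlternative G)
    {H : Subgroup G} (hH : H.FG)
    (hinf : ∀ y : List X, ¬ (psi y '' (H.map G.subtype : Set (TreeAut X))).Finite)
    (L : ℕ → Subgroup G) (hL : Monotone L) (hHL : ∀ i, H ≤ L i) : ∃ n, ∀ m ≥ n, L m = L n := by
  have := hji.1
  have : Nontrivial X := nontrivial_of_infinite (G := G)
  have hle : ∀ A : Subgroup G, A.map G.subtype ≤ G := Subgroup.map_subtype_le
  obtain ⟨y, hy⟩ | ⟨Y, hY, hHY⟩ := hGN (H.map G.subtype) (hle H) ((Subgroup.fg_map_subtype_iff H).2 hH)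
  · exact absurd hy (hinf y)
  · obtain ⟨n, hn⟩ := chain_stabilizes_of_isInfraDirectProduct hji hss hY hHY
      (L := fun i => (L i).map G.subtype) (fun i j hij => Subgroup.map_mono (hL hij))
      (fun i => Subgroup.map_mono (hHL i)) (fun i => hle _)
    exact ⟨n, fun m hm => Subgroup.map_injective G.subtype_injective (hn m hm)⟩

/-! ### Approximating subgroups with a finite section -/

theorem exists_words_in_distinct_orbits [Finite X] [Nontrivial X] {H : Subgroup (TreeAut X)}
    {y : List X} (hy : (psi y '' (H : Set (TreeAut X))).Finite) :
    ∃ N, ∀ m ≥ N, ∃ u ∈ level X m, ∃ v ∈ level X m, ∀ h ∈ H, h (y ++ u) ≠ y ++ v := by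
  -- A single orbit below y would give at most |ψ_y(H)| words of length m, while |X^m| > m.
  refine ⟨(psi y '' (H : Set (TreeAut X))).ncard, fun m hm => ?_⟩
  obtain ⟨x⟩ := (inferInstance : Nonempty X)
  refine ⟨List.replicate m x, by simp [level], ?_⟩
  by_contra! hcon
  have hsub : level X m ⊆ (fun f : TreeAut X => f (List.replicate m x)) ''
      (psi y '' (H : Set (TreeAut X))) := by
    intro v hv
    obtain ⟨h, hh, e⟩ := hcon v hv
    rw [apply_append] at e
    exact ⟨_, ⟨h, hh, rfl⟩, (List.append_inj e (by simp)).2⟩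
  have h1 := Set.ncard_le_ncard hsub (hy.image _)
  have h2 := Set.ncard_image_le (f := fun f : TreeAut X => f (List.replicate m x)) hy
  have h3 := lt_ncard_level (X := X) m
  lia

theorem infinite_of_isFiniteIndexSubgroup {Γ : Type*} [Group Γ] {K G : Subgroup Γ}
    (hG : Infinite G) (hK : IsFiniteIndexSubgroup K G) : (K : Set Γ).Infinite := by
  intro hfin
  have := hK.2.to_finiteIndex_subgroupOf
  have : Finite (K.subgroupOf G) := by
    have : Finite K := hfin
    exact Finite.of_equiv _ (Subgroup.subgroupOfEquivOfLe hK.1).symm.toEquiv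
  have : Finite G := Finite.of_equiv _ (Subgroup.groupEquivQuotientProdSubgroup
    (s := K.subgroupOf G)).symm
  exact not_finite G

open scoped Pointwise in
/-- A finitely generated subgroup with a finite section is approximated by other subgroups with
a finite section. -/
theorem exists_ne_of_finite_section [Finite X] {G : Subgroup (TreeAut X)}
    (hbranch : IsRegularBranch G) (hinf : Infinite G) (happrox : HasWellApproximatedSubgroups G)
    {H : Subgroup (TreeAut X)} (hHG : H ≤ G) (hH : H.FG) {y : List X}
    (hy : (psi y '' (H : Set (TreeAut X))).Finite) {F : Set (TreeAut X)} (hF : F.Finite) :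
    ∃ L ≤ G, (∃ u : List X, (psi u '' (L : Set (TreeAut X))).Finite) ∧ L ≠ H ∧
      ∀ g ∈ F, (g ∈ L ↔ g ∈ H) := by
  have : Nontrivial X := nontrivial_of_infinite (G := G)
  obtain ⟨hss, -, K, hKG, hKn, -, hKlevel⟩ := hbranch
  -- Since `st_G(n)` decreases, a level excluding g from `H st_G(n)` works for all deeper ones, so
  -- one n serves all of F.
  have hev : ∀ g ∈ F, ∀ᶠ n in Filter.atTop,
      g ∈ (H : Set (TreeAut X)) * (st G (level X n) : Set (TreeAut X)) → g ∈ H := by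
    intro g _
    by_cases hg : g ∈ H
    · exact Filter.Eventually.of_forall fun _ _ => hg
    · have hg' : g ∉ (H : Set (TreeAut X)) := hg
      rw [← happrox H hHG hH, Set.mem_iInter] at hg'
      push Not at hg'
      obtain ⟨n, hn⟩ := hg'
      filter_upwards [Filter.eventually_ge_atTop n] with m hm hgm
      exact absurd (Set.mul_subset_mul_left (st_level_antitone G hm) hgm) hn
  obtain ⟨N, hN⟩ := exists_words_in_distinct_orbits hy
  obtain ⟨n, hn, hnN⟩ := (((Filter.eventually_all_finite hF).2 hev).and
    (Filter.eventually_ge_atTop (y.length + N))).exists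
  obtain ⟨u', hu', v', hv', huv⟩ := hN (n - y.length) (by lia)
  have hsec : ∀ w, (psi (y ++ w) '' (H : Set (TreeAut X))).Finite := fun w => by
    have e : psi (y ++ w) '' (H : Set (TreeAut X)) = psi w '' (psi y '' (H : Set (TreeAut X))) := by
      rw [Set.image_image]
      exact Set.image_congr fun g _ => psi_append y w g
    exact e ▸ hy.image _
  have hlen : ∀ w ∈ level X (n - y.length), y ++ w ∈ level X n := fun w hw => by
    have hw' : w.length = n - y.length := hw
    simp only [level, Set.mem_ofPred_eq, List.length_append, hw']
    lia
  have hu := hlen u' hu'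
  have hv := hlen v' hv'
  have hfu := hsec u'
  have hfv := hsec v'
  generalize y ++ u' = u at *
  generalize y ++ v' = v at *
  -- The H-orbit of v: its invariance, with normality of K, makes H normalize R, so that `H ⊔ R` is
  -- the product HR.
  set Y : Set (List X) := {w | ∃ h ∈ H, h v = w} with hYdef
  have hYlevel : Y ⊆ level X n := by
    rintro _ ⟨h, -, rfl⟩
    exact (length_apply h v).trans hv
  have huY : u ∉ Y := by
    rintro ⟨h, hh, e⟩
    refine huv h⁻¹ (inv_mem hh) ?_
    rw [← e]
    exact RelIso.inv_apply_self h v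
  set R := copies K Y with hR
  have hRn : R ≤ copies K (level X n) := copies_le_copies_level hYlevel
  have hRG : R ≤ G := hRn.trans (hKlevel n).1
  have hnorm : H ≤ Subgroup.normalizer (R : Set (TreeAut X)) := by
    have hconj : ∀ h ∈ H, ∀ r ∈ R, h * r * h⁻¹ ∈ R := fun h hh r hr => by
      refine conj_mem_copies (fun w => ⟨?_, ?_⟩) (fun w k hk => ?_) hr
      · rintro ⟨h', hh', e⟩
        refine ⟨h⁻¹ * h', mul_mem (inv_mem hh) hh', ?_⟩
        rw [RelIso.mul_apply, e]
        exact RelIso.inv_apply_self h w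
      · rintro ⟨h', hh', rfl⟩
        exact ⟨h * h', mul_mem hh hh', rfl⟩
      · exact hKn.conj_mem ⟨k, hKG.1 hk⟩ hk ⟨psi w h, hss h (hHG hh) w⟩
    refine fun h hh => Subgroup.mem_normalizer_iff.2 fun r => ⟨hconj h hh r, fun hr => ?_⟩
    have := hconj h⁻¹ (inv_mem hh) _ hr
    convert this using 1
    group
  have hmem : ∀ g ∈ H ⊔ R, ∃ h ∈ H, ∃ r ∈ R, h * r = g := fun g hg => by
    have hg' : g ∈ ((H ⊔ R : Subgroup (TreeAut X)) : Set (TreeAut X)) := hg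
    rwa [Subgroup.coe_mul_of_left_le_normalizer_right H R hnorm] at hg'
  refine ⟨H ⊔ R, sup_le hHG hRG, ⟨u, hfu.subset ?_⟩, fun he => ?_, fun g hg => ⟨fun hgL => ?_,
    fun h => le_sup_left (b := R) h⟩⟩
  · rintro _ ⟨g, hg, rfl⟩
    obtain ⟨h, hh, r, hr, rfl⟩ := hmem g hg
    obtain ⟨e1, e2⟩ := psi_eq_one_of_mem_copies hYlevel hu huY hr
    exact ⟨h, hh, by rw [psi_mul, e1, e2, mul_one]⟩
  -- If R were inside H, the finite section at v would contain the infinite group K.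
  · refine infinite_of_isFiniteIndexSubgroup hinf hKG (hfv.subset fun k hk => ?_)
    have hb : below v k ∈ R :=
      below_mem_copies hYlevel ⟨1, one_mem _, rfl⟩ hk
    exact ⟨below v k, he ▸ le_sup_right (a := H) hb, psi_below v k⟩
  · obtain ⟨h, hh, r, hr, rfl⟩ := hmem g hgL
    exact hn _ hg ⟨h, hh, r, mem_st.2 ⟨hRG hr, fun w hw => ((hRn hr).1 w hw).1⟩, rfl⟩

end TreeAut

/-! ### The characterization -/

theorem mainTheorem2 {X : Type*} [Finite X] (G : Subgroup (TreeAut X))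
    (hfg : G.FG)
    (hbranch : TreeAut.IsRegularBranch G)
    (hji : IsJustInfinite G)
    (hrep : TreeAut.IsStronglySelfReplicating G)
    (happrox : TreeAut.HasWellApproximatedSubgroups G)
    (hGN : TreeAut.GrigorchukNagnibedaAlternative G)
    (H : Subgroup (TreeAut X)) (hH : H ≤ G) :
    H.subgroupOf G ∈ perfectKernelSub G ↔
      (∃ y : List X, (TreeAut.psi y '' (H : Set (TreeAut X))).Finite) ∨ ¬ H.FG := by
  have hmap : (H.subgroupOf G).map G.subtype = H := Subgroup.map_subgroupOf_eq_of_le hH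
  constructor
  · intro hmem
    by_contra! hcon
    have hHfg : (H.subgroupOf G).FG := (Subgroup.fg_map_subtype_iff _).1 (hmap.symm ▸ hcon.2)
    exact notMem_perfectKernelSub_of_chain_stabilizes hHfg
      (TreeAut.chain_stabilizes_of_infinite_sections hji hbranch.1 hGN hHfg
        (fun y => hmap.symm ▸ hcon.1 y)) hmem
  · intro h
    refine subset_perfectKernelSub (S := {L : Subgroup G |
      (∃ y : List X, (TreeAut.psi y '' (L.map G.subtype : Set (TreeAut X))).Finite) ∨ ¬ L.FG})
      (fun L hL F hF => ?_) (show _ ∨ _ by rwa [← Subgroup.fg_map_subtype_iff, hmap])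
    by_cases hLfg : L.FG
    · obtain ⟨y, hy⟩ := hL.resolve_right (not_not.2 hLfg)
      obtain ⟨A, hAG, hA, hne, hAF⟩ := TreeAut.exists_ne_of_finite_section hbranch hji.1 happrox
        (Subgroup.map_subtype_le L) ((Subgroup.fg_map_subtype_iff L).2 hLfg) hy (hF.image G.subtype)
      have hAmap : (A.subgroupOf G).map G.subtype = A := Subgroup.map_subgroupOf_eq_of_le hAG
      refine ⟨A.subgroupOf G, Or.inl (by rwa [hAmap]), fun e => hne (by rw [← e, hAmap]),
        fun g hg => ?_⟩
      have := hAF g ⟨g, hg, rfl⟩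
      rw [Subgroup.mem_subgroupOf, this]
      exact Subgroup.mem_map_iff_mem G.subtype_injective
    · have hfin : (F ∩ L).Finite := hF.subset Set.inter_subset_left
      have hA : (Subgroup.closure (F ∩ L)).FG := ⟨hfin.toFinset, by simp⟩
      -- This closure agrees with L on F. If all its sections were infinite, its overgroup L would
      -- be finitely generated.
      have hle : Subgroup.closure (F ∩ L) ≤ L := (Subgroup.closure_le L).2 Set.inter_subset_right
      refine ⟨Subgroup.closure (F ∩ L), Or.inl ?_, fun e => hLfg (e ▸ hA), fun g hg =>
        ⟨fun hgA => hle hgA, fun hgL => Subgroup.subset_closure ⟨hg, hgL⟩⟩⟩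
      by_contra! hcon
      exact hLfg (hA.of_le_of_chain_stabilizes
        (TreeAut.chain_stabilizes_of_infinite_sections hji hbranch.1 hGN hA hcon) hle)
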